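/- Let $S\subset\mathbb Z$ be a finite set containing at least one positive and at least one negative integer. For $n\ge 0$, let $\mathcal W_n$ be the (finite) set of lattice walks from $(0,0)$ to $(n,0)$ with $n$ steps of the form $(x,y)\to(x+1,y+s)$, $s\in S$, that never go below the $x$-axis (the empty walk is the unique element of $\mathcal W_0$). Define the area of a walk $w\in\mathcal W_n$ as the sum of the $y$-coordinates of its intermediate lattice points, a non-negative integer, and let $$f(t,q)=\sum_{n\ge 0}\Big(\sum_{w\in\mathcal W_n}q^{\operatorname{area}(w)}\Big)t^n\in\mathbb Q[q][[t]].$$ Expand $f$ (coefficientwise in $t$) in powers of $q-1$: $$f(t,q)=\sum_{k\ge 0}f_k(t)\,(q-1)^k,\qquad f_k(t)\in\mathbb Q[[t]].$$ Then, for every $k\ge 0$, $k!\,f_k(t)$ is the generating function of the $k$-th factorial moments (unnormalized) of the area, $$k!\,f_k(t)=\sum_{n\ge 0}\Big(\sum_{w\in\mathcal W_n}\operatorname{area}(w)\,(\operatorname{area}(w)-1)\cdots(\operatorname{area}(w)-k+1)\Big)t^n,$$ and $f_k(t)$ is an algebraic formal power series: there is a nonzero polynomial $P(t,X)\in\mathbb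 Q[t][X]$ with $P(t,f_k(t))=0$. -/

import Mathlib

open scoped Polynomial PowerSeries Nat

namespace DyckArea

/-- The `y`-coordinate of the walk from the origin with successive steps
`(1, w 0), (1, w 1), …` after its first `m` steps. -/
def height {n : ℕ} (w : Fin n → ℤ) (m : ℕ) : ℤ :=
  ∑ j : Fin n with j.val < m, w j

/-- The walks with `n` steps `(1, s)`, `s ∈ S`, from `(0, 0)` to `(n, 0)` that never go below
the `x`-axis. A walk is given by the sequence of its vertical increments. -/
def walks (S : Finset ℤ) (n : ℕ) : Finset (Fin n → ℤ) :=
  {w ∈ Fintype.piFinset fun _ : Fin n => S |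
    (∀ m : Fin (n + 1), 0 ≤ height w m) ∧ height w n = 0}

/-- The area under a walk: the sum of the `y`-coordinates of its intermediate points. It is a
natural number because the walks considered are weakly above the `x`-axis. -/
def area {n : ℕ} (w : Fin n → ℤ) : ℕ :=
  (∑ m ∈ Finset.Ioo 0 n, height w m).toNat

/-- The weight enumerator `f(t, q) = ∑ t ^ length * q ^ area`, as a formal power series in `t`
with coefficients in `ℚ[q]` (there are finitely many walks of each length). -/
noncomputable def areaGF (S : Finset ℤ) : ℚ[X]⟦X⟧ :=
  PowerSeries.mk fun n => ∑ w ∈ walks S n, (Polynomial.X : ℚ[X]) ^ area w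

/-- The coefficient `f_k(t)` of `(q - 1) ^ k` in the expansion of `f(t, q)` about `q = 1`. -/
noncomputable def areaCoeff (S : Finset ℤ) (k : ℕ) : ℚ⟦X⟧ :=
  PowerSeries.mk fun n => (Polynomial.taylor 1 (PowerSeries.coeff n (areaGF S))).coeff k

end DyckArea

/-! ### Derivations that detect algebraic elements -/

open scoped IntermediateField TensorProduct
open KaehlerDifferential

/-! Expand in powers of q - 1. Replacing t by q^c t changes the k-th coefficient only by terms
obtained from lower coefficients through t d/dt, which preserves algebraicity
(`isAlgebraic_taylorCoeff_dilate_sub`). A finite polynomial system in series and their dilations,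
contracting in t, is therefore handled by induction on k. A derivation on ℚ⟦t⟧ that kills exactly
the algebraic series sends the k-th coefficients to generators of a module N with N ⊆ tN, and
Nakayama gives N = 0 (`subset_algebraicSubring_of_system`).

Walks supply such a system. Let c bound all |s|; the unknowns enumerate walks between heights below
c. If the first step reaches height at least c, the portion before the next passage below c is a
walk lifted by c. Each of its steps gains a factor q^c, whence a dilation (`walkGF_add`). The moment
formula is the binomial expansion of q^area at q = 1. -/

theorem IntermediateField.derivation_eq_zero_of_adjoin_simple {K L M : Type*} [Field K] [Field L]
    [Algebra K L] (x : L) [AddCommGroup M] [Module K⟮x⟯ M] [Module K M]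
    (D : Derivation K K⟮x⟯ M)
    (hx : D (IntermediateField.AdjoinSimple.gen K x) = 0) : D = 0 := by
  ext ⟨y, hy⟩
  simp only [Derivation.coe_zero, Pi.zero_apply]
  induction hy using IntermediateField.adjoin_induction with
  | mem y hy =>
    obtain rfl : y = x := by simpa using hy
    exact hx
  | algebraMap r => exact D.map_algebraMap r
  | add a b ha hb iha ihb =>
    have := D.map_add ⟨a, ha⟩ ⟨b, hb⟩
    rw [iha, ihb, add_zero] at this
    exact this
  | inv a ha iha =>
    have := D.leibniz_inv ⟨a, ha⟩
    rw [iha, smul_zero] at this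
    exact this
  | mul a b ha hb iha ihb =>
    have := D.leibniz ⟨a, ha⟩ ⟨b, hb⟩
    rw [iha, ihb, smul_zero, smul_zero, add_zero] at this
    exact this

theorem Algebra.FormallySmooth.of_charZero_field (K L : Type*) [Field K] [Field L] [Algebra K L]
    [CharZero K] : Algebra.FormallySmooth K L := by
  obtain ⟨s, hs⟩ := exists_isTranscendenceBasis K L
  have := hs.isAlgebraic_field
  exact Algebra.FormallySmooth.of_algebraicIndependent_of_isSeparable hs.1

/-- In characteristic zero L is formally smooth over K(x), so differentials of K(x) inject into
those of L after base change. Thus dx already vanishes over K(x), which is then unramified, hence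
separable algebraic, over K. -/
theorem KaehlerDifferential.isAlgebraic_of_D_eq_zero {K L : Type} [Field K] [Field L] [Algebra K L]
    [CharZero K] {x : L} (hx : KaehlerDifferential.D K L x = 0) : IsAlgebraic K x := by
  have : Algebra.FormallySmooth K⟮x⟯ L := .of_charZero_field _ _
  set g := IntermediateField.AdjoinSimple.gen K x
  have hinj : Function.Injective (KaehlerDifferential.mapBaseChange K K⟮x⟯ L) := by
    rw [injective_iff_map_eq_zero]
    intro a ha
    obtain ⟨b, rfl⟩ := (Algebra.H1Cotangent.exact_δ_mapBaseChange K K⟮x⟯ L a).mp ha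
    rw [Subsingleton.elim b 0, map_zero]
  have h1 : (1 : L) ⊗ₜ[K⟮x⟯] KaehlerDifferential.D K K⟮x⟯ g = 0 := by
    apply hinj
    rw [map_zero, KaehlerDifferential.mapBaseChange_tmul, KaehlerDifferential.map_D, one_smul]
    exact hx
  have h2 : KaehlerDifferential.D K K⟮x⟯ g = 0 :=
    Module.FaithfullyFlat.tensorProduct_mk_injective (A := K⟮x⟯) (B := L) _ (by simpa using h1)
  have h3 := IntermediateField.derivation_eq_zero_of_adjoin_simple x _ h2
  have h4 : Subsingleton (Ω[K⟮x⟯⁄K]) := by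
    rw [← Submodule.subsingleton_iff K⟮x⟯, ← subsingleton_iff_bot_eq_top,
      ← KaehlerDifferential.span_range_derivation, h3]
    simp
  have : Algebra.FormallyUnramified K K⟮x⟯ := ⟨h4⟩
  have : Algebra.EssFiniteType K K⟮x⟯ :=
    IntermediateField.essFiniteType_iff.2
      (IntermediateField.fg_adjoin_of_finite (Set.finite_singleton x))
  have := (Algebra.FormallyUnramified.iff_isSeparable K K⟮x⟯).1 inferInstance
  have h5 := Algebra.IsAlgebraic.isAlgebraic (R := K) g
  exact h5.algebraMap (A := L)

theorem IsAlgebraic.exists_aeval_derivative_ne_zero {A S : Type*} [CommRing A] [IsDomain A]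
    [CommRing S] [IsDomain S] [CharZero A] [Algebra A S] [FaithfulSMul A S] {x : S}
    (hx : IsAlgebraic A x) :
    ∃ p : A[X], Polynomial.aeval x p = 0 ∧ Polynomial.aeval x p.derivative ≠ 0 := by
  classical
  have hex : ∃ n, ∃ p : A[X], p ≠ 0 ∧ p.natDegree = n ∧ Polynomial.aeval x p = 0 := by
    obtain ⟨p, hp, hpx⟩ := hx
    exact ⟨_, p, hp, rfl, hpx⟩
  -- For an annihilator of minimal degree, the derivative is nonzero of smaller degree, so it cannot
  -- annihilate x.
  obtain ⟨p, hp, hdeg, hpx⟩ := Nat.find_spec hex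
  have hp0 : p.natDegree ≠ 0 := by
    intro h0
    rw [Polynomial.eq_C_of_natDegree_eq_zero h0, Polynomial.aeval_C] at hpx
    rw [Polynomial.eq_C_of_natDegree_eq_zero h0] at hp
    exact hp (by rw [(FaithfulSMul.algebraMap_injective A S)
      (hpx.trans (map_zero _).symm), map_zero])
  refine ⟨p, hpx, fun h0 => ?_⟩
  refine Nat.find_min hex (m := p.derivative.natDegree) ?_ ⟨_, ?_, rfl, h0⟩
  · rw [← hdeg]
    exact Polynomial.natDegree_derivative_lt hp0
  · exact fun h => hp0 (Polynomial.derivative_eq_zero.1 h)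

theorem Derivation.eq_zero_of_isAlgebraic {A S M : Type*} [CommRing A] [IsDomain A] [CommRing S]
    [IsDomain S] [CharZero A] [Algebra A S] [FaithfulSMul A S] [AddCommGroup M] [Module A M]
    [Module S M] [IsScalarTower A S M] [Module.IsTorsionFree S M] (d : Derivation A S M) {x : S}
    (hx : IsAlgebraic A x) : d x = 0 := by
  obtain ⟨p, hpx, hder⟩ := hx.exists_aeval_derivative_ne_zero
  have := d.map_aeval p x
  rw [hpx, map_zero] at this
  exact (smul_eq_zero.1 this.symm).resolve_left hder

/-- This makes algebraicity a linear condition. The derivation is the universal one of the fraction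
fields, restricted to S. -/
theorem exists_derivation_eq_zero_iff_isAlgebraic (A S : Type) [CommRing A] [IsDomain A]
    [CommRing S] [IsDomain S] [CharZero A] [Algebra A S] [FaithfulSMul A S] :
    ∃ (M : Type) (_ : AddCommGroup M) (_ : Module A M) (_ : Module S M) (d : Derivation A S M),
      ∀ x, d x = 0 ↔ IsAlgebraic A x := by
  let K := FractionRing A
  let L := FractionRing S
  let : Algebra K L := FractionRing.liftAlgebra A L
  have : IsScalarTower A K L := FractionRing.isScalarTower_liftAlgebra A L
  have : CharZero K := charZero_of_injective_algebraMap (IsFractionRing.injective A K)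
  let D : Derivation A L (Ω[L⁄K]) := (KaehlerDifferential.D K L).restrictScalars A
  refine ⟨Ω[L⁄K], inferInstance, inferInstance, inferInstance, D.compAlgebraMap S, fun x => ?_⟩
  have key : IsAlgebraic A x ↔ IsAlgebraic K (algebraMap S L x) := by
    rw [← IsFractionRing.isAlgebraic_iff A K L,
      isAlgebraic_algebraMap_iff (IsFractionRing.injective S L)]
  rw [key]
  refine ⟨fun h => KaehlerDifferential.isAlgebraic_of_D_eq_zero h, fun h => ?_⟩
  exact Derivation.eq_zero_of_isAlgebraic (KaehlerDifferential.D K L) h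

/-! ### Closure properties of algebraic power series -/

namespace PowerSeries

theorem algebraMap_polynomial_eq_coe (p : ℚ[X]) : algebraMap ℚ[X] ℚ⟦X⟧ p = (p : ℚ⟦X⟧) :=
  rfl

instance : FaithfulSMul ℚ[X] ℚ⟦X⟧ :=
  (faithfulSMul_iff_algebraMap_injective _ _).2 (Polynomial.coe_injective ℚ)

theorem isAlgebraic_aeval {f : ℚ⟦X⟧} (hf : IsAlgebraic ℚ[X] f) (q : ℚ[X][X]) :
    IsAlgebraic ℚ[X] (Polynomial.aeval f q) := by
  have h : Algebra.adjoin ℚ[X] {f} ≤ Subalgebra.algebraicClosure ℚ[X] ℚ⟦X⟧ :=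
    Algebra.adjoin_le (Set.singleton_subset_iff.2 hf)
  exact h (Polynomial.aeval_mem_adjoin_singleton _ _)

/-- Chain rule: q is p with its coefficients differentiated in t. -/
theorem exists_derivative_aeval (f : ℚ⟦X⟧) (p : ℚ[X][X]) : ∃ q : ℚ[X][X],
    d⁄dX ℚ (Polynomial.aeval f p) =
      Polynomial.aeval f q + Polynomial.aeval f p.derivative * d⁄dX ℚ f := by
  induction p using Polynomial.induction_on' with
  | add p q hp hq =>
    obtain ⟨p', hp'⟩ := hp
    obtain ⟨q', hq'⟩ := hq
    refine ⟨p' + q', ?_⟩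
    simp only [map_add, hp', hq']
    ring
  | monomial n a =>
    refine ⟨Polynomial.monomial n a.derivative, ?_⟩
    simp only [Polynomial.aeval_monomial, Polynomial.derivative_monomial, Derivation.leibniz,
      derivative_pow, smul_eq_mul, map_mul, map_natCast, algebraMap_polynomial_eq_coe,
      derivative_coe]
    ring

theorem isAlgebraic_derivative {f : ℚ⟦X⟧} (hf : IsAlgebraic ℚ[X] f) :
    IsAlgebraic ℚ[X] (d⁄dX ℚ f) := by
  obtain ⟨p, hpx, hder⟩ := hf.exists_aeval_derivative_ne_zero
  obtain ⟨q, hq⟩ := exists_derivative_aeval f p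
  rw [hpx, map_zero] at hq
  -- Differentiating p(f) = 0 makes p'(f) f' algebraic; the nonzero algebraic factor p'(f) cancels.
  refine IsAlgebraic.of_mul (mem_nonZeroDivisors_of_ne_zero hder) (isAlgebraic_aeval hf _) ?_
  rw [eq_neg_of_add_eq_zero_right hq.symm]
  exact (isAlgebraic_aeval hf _).neg

theorem isAlgebraic_sum {ι : Type*} {s : Finset ι} {f : ι → ℚ⟦X⟧}
    (hf : ∀ i ∈ s, IsAlgebraic ℚ[X] (f i)) : IsAlgebraic ℚ[X] (∑ i ∈ s, f i) :=
  (Subalgebra.algebraicClosure ℚ[X] ℚ⟦X⟧).sum_mem hf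

theorem isAlgebraic_X : IsAlgebraic ℚ[X] (X : ℚ⟦X⟧) := by
  rw [← Polynomial.coe_X, ← algebraMap_polynomial_eq_coe]
  exact isAlgebraic_algebraMap _

theorem isAlgebraic_C (a : ℚ) : IsAlgebraic ℚ[X] (C a : ℚ⟦X⟧) := by
  rw [← Polynomial.coe_C, ← algebraMap_polynomial_eq_coe]
  exact isAlgebraic_algebraMap _

/-- Multiplying the coefficients of an algebraic series by the values of a polynomial gives an
algebraic series. -/
theorem isAlgebraic_mk_eval_mul (p : ℚ[X]) {f : ℚ⟦X⟧} (hf : IsAlgebraic ℚ[X] f) :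
    IsAlgebraic ℚ[X] (mk fun n => p.eval (n : ℚ) * coeff n f) := by
  induction p using Polynomial.induction_on with
  | C a =>
    have : (mk fun n => (Polynomial.C a).eval (n : ℚ) * coeff n f) = C a * f := by
      ext n
      simp
    rw [this]
    exact (isAlgebraic_C a).mul hf
  | add p q hp hq =>
    have : (mk fun n => (p + q).eval (n : ℚ) * coeff n f) =
        (mk fun n => p.eval (n : ℚ) * coeff n f) + mk fun n => q.eval (n : ℚ) * coeff n f := by
      ext n
      simp [add_mul]
    rw [this]
    exact hp.add hq
  | monomial m a h =>
    -- The operator t d/dt multiplies the n-th coefficient by n.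
    have : (mk fun n => (Polynomial.C a * Polynomial.X ^ (m + 1)).eval (n : ℚ) * coeff n f) =
        X * d⁄dX ℚ (mk fun n => (Polynomial.C a * Polynomial.X ^ m).eval (n : ℚ) * coeff n f) := by
      ext n
      cases n with
      | zero => simp
      | succ n =>
        simp only [coeff_mk, Polynomial.eval_mul, Polynomial.eval_C, Polynomial.eval_pow,
          Polynomial.eval_X, coeff_succ_X_mul, coeff_derivative]
        push_cast
        ring
    rw [this]
    exact isAlgebraic_X.mul (isAlgebraic_derivative h)

theorem isAlgebraic_mk_choose_mul (c i : ℕ) {f : ℚ⟦X⟧} (hf : IsAlgebraic ℚ[X] f) :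
    IsAlgebraic ℚ[X] (mk fun n => ((c * n).choose i : ℚ) * coeff n f) := by
  convert isAlgebraic_mk_eval_mul
    (Polynomial.C (i ! : ℚ)⁻¹ * (descPochhammer ℚ i).comp (Polynomial.C (c : ℚ) * Polynomial.X)) hf
  have hi : (i ! : ℚ) ≠ 0 := by positivity
  rename_i n
  have : ((c * n).descFactorial i : ℚ) = i ! * (c * n).choose i := by
    exact_mod_cast Nat.descFactorial_eq_factorial_mul_choose _ _
  rw [← descPochhammer_eval_eq_descFactorial] at this
  push_cast at this
  simp only [Polynomial.eval_mul, Polynomial.eval_C, Polynomial.eval_comp, Polynomial.eval_X, this]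
  field_simp

end PowerSeries

/-! ### Expansion about q = 1 and contracting systems -/

namespace DyckArea

open PowerSeries

/-- The coefficient of `(q - 1) ^ k` in the expansion about `q = 1` of a power series with
coefficients in `ℚ[q]`. -/
noncomputable def taylorCoeff (k : ℕ) : ℚ[X]⟦X⟧ →+ ℚ⟦X⟧ where
  toFun f := mk fun n => (Polynomial.taylor 1 (coeff n f)).coeff k
  map_zero' := by ext; simp
  map_add' f g := by ext; simp

theorem coeff_taylorCoeff (k n : ℕ) (f : ℚ[X]⟦X⟧) :
    coeff n (taylorCoeff k f) = (Polynomial.taylor 1 (coeff n f)).coeff k := by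
  simp [taylorCoeff]

theorem taylorCoeff_mul (k : ℕ) (f g : ℚ[X]⟦X⟧) :
    taylorCoeff k (f * g) =
      ∑ p ∈ Finset.HasAntidiagonal.antidiagonal k, taylorCoeff p.1 f * taylorCoeff p.2 g := by
  ext n
  simp only [coeff_taylorCoeff, coeff_mul, map_sum, Polynomial.taylor_mul,
    Polynomial.finsetSum_coeff, Polynomial.coeff_mul]
  exact Finset.sum_comm

theorem taylorCoeff_C (k : ℕ) (p : ℚ[X]) :
    taylorCoeff k (C p) = C ((Polynomial.taylor 1 p).coeff k) := by
  ext n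
  rw [coeff_taylorCoeff, coeff_C, coeff_C]
  split_ifs <;> simp

theorem taylorCoeff_X_mul (k : ℕ) (f : ℚ[X]⟦X⟧) :
    taylorCoeff k (X * f) = X * taylorCoeff k f := by
  ext n
  cases n <;> simp [coeff_taylorCoeff, coeff_succ_X_mul]

/-- The power series all of whose coefficients about `q = 1` are algebraic. -/
noncomputable def algebraicSubring : Subring ℚ[X]⟦X⟧ where
  carrier := {f | ∀ k, IsAlgebraic ℚ[X] (taylorCoeff k f)}
  zero_mem' k := by simpa using isAlgebraic_zero
  one_mem' k := by
    rw [← map_one C, taylorCoeff_C]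
    exact isAlgebraic_C _
  add_mem' hf hg k := by
    rw [map_add]
    exact (hf k).add (hg k)
  neg_mem' hf k := by
    rw [map_neg]
    exact (hf k).neg
  mul_mem' hf hg k := by
    rw [taylorCoeff_mul]
    exact isAlgebraic_sum fun p _ => (hf _).mul (hg _)

theorem C_mem_algebraicSubring (p : ℚ[X]) : C p ∈ algebraicSubring := fun k => by
  rw [taylorCoeff_C]
  exact isAlgebraic_C _

theorem X_mem_algebraicSubring : X ∈ algebraicSubring := fun k => by
  rw [← mul_one X, taylorCoeff_X_mul]
  exact isAlgebraic_X.mul (algebraicSubring.one_mem k)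

/-- The substitution `t ↦ q ^ c * t`. -/
noncomputable def dilate (c : ℕ) (f : ℚ[X]⟦X⟧) : ℚ[X]⟦X⟧ :=
  mk fun n => Polynomial.X ^ (c * n) * coeff n f

/-- Since q^(cn) = (1 + (q - 1))^(cn), its coefficients are binomials, polynomial in n. The constant
one reproduces the k-th coefficient of f; the others meet only lower coefficients. -/
theorem isAlgebraic_taylorCoeff_dilate_sub (c k : ℕ) (f : ℚ[X]⟦X⟧)
    (hf : ∀ l < k, IsAlgebraic ℚ[X] (taylorCoeff l f)) :
    IsAlgebraic ℚ[X] (taylorCoeff k (dilate c f) - taylorCoeff k f) := by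
  have h : taylorCoeff k (dilate c f) = ∑ p ∈ Finset.HasAntidiagonal.antidiagonal k,
      mk fun n => ((c * n).choose p.1 : ℚ) * coeff n (taylorCoeff p.2 f) := by
    ext n
    simp only [coeff_taylorCoeff, dilate, coeff_mk, Polynomial.taylor_mul, Polynomial.taylor_X_pow,
      Polynomial.coeff_mul, map_sum, map_one, Polynomial.coeff_X_add_one_pow]
  have h0 : (0, k) ∈ Finset.HasAntidiagonal.antidiagonal k := by simp
  rw [h, ← Finset.add_sum_erase _ _ h0]
  have h1 : (mk fun n => ((c * n).choose 0 : ℚ) * coeff n (taylorCoeff k f)) = taylorCoeff k f := by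
    ext n
    simp
  rw [h1, add_sub_cancel_left]
  refine isAlgebraic_sum fun p hp => isAlgebraic_mk_choose_mul _ _ (hf _ ?_)
  obtain ⟨i, j⟩ := p
  simp only [Finset.mem_erase, ne_eq, Prod.mk.injEq, not_and,
    Finset.HasAntidiagonal.mem_antidiagonal] at hp
  dsimp only
  by_contra hj
  exact hp.1 (by omega) (by omega)

/-- A finite set of series that satisfies a polynomial system, contracting in `t`, in the
series themselves and their dilations has algebraic coefficients about `q = 1`. -/
theorem subset_algebraicSubring_of_system (c : ℕ) (s : Set ℚ[X]⟦X⟧) (hs : s.Finite)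
    (h : ∀ x ∈ s, ∃ b ∈ algebraicSubring,
      ∃ y ∈ Subring.closure ((algebraicSubring : Set ℚ[X]⟦X⟧) ∪ s ∪ dilate c '' s),
        x = b + X * y) : s ⊆ algebraicSubring := by
  suffices H : ∀ k, ∀ x ∈ s, IsAlgebraic ℚ[X] (taylorCoeff k x) from fun x hx k => H k x hx
  intro k
  induction k using Nat.strong_induction_on with
  | h k ih =>
    obtain ⟨M, _, _, _, d, hd⟩ := exists_derivation_eq_zero_iff_isAlgebraic ℚ[X] ℚ⟦X⟧
    set N : Submodule ℚ⟦X⟧ M := Submodule.span _ ((fun x => d (taylorCoeff k x)) '' s) with hN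
    have hgen : ∀ x ∈ s, ∀ l ≤ k, d (taylorCoeff l x) ∈ N := fun x hx l hl => by
      rcases hl.lt_or_eq with hl | rfl
      · rw [(hd _).2 (ih l hl x hx)]
        exact N.zero_mem
      · exact Submodule.subset_span ⟨x, hx, rfl⟩
    -- All orders l ≤ k are carried along because the product rule mixes them.
    have hcl : ∀ y ∈ Subring.closure ((algebraicSubring : Set ℚ[X]⟦X⟧) ∪ s ∪ dilate c '' s),
        ∀ l ≤ k, d (taylorCoeff l y) ∈ N := fun y hy => by
      induction hy using Subring.closure_induction with
      | mem y hy =>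
        intro l hl
        rcases hy with (hy | hy) | ⟨x, hx, rfl⟩
        · rw [(hd _).2 (hy l)]
          exact N.zero_mem
        · exact hgen y hy l hl
        · have := isAlgebraic_taylorCoeff_dilate_sub c l x fun i hi => ih i (by omega) x hx
          rw [← hd, map_sub, sub_eq_zero] at this
          rw [this]
          exact hgen x hx l hl
      | zero => simp
      | one =>
        intro l _
        rw [(hd _).2 (algebraicSubring.one_mem l)]
        exact N.zero_mem
      | add x y _ _ hx hy =>
        intro l hl
        rw [map_add, map_add]
        exact N.add_mem (hx l hl) (hy l hl)
      | neg x _ hx =>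
        intro l hl
        rw [map_neg, map_neg]
        exact N.neg_mem (hx l hl)
      | mul x y _ _ hx hy =>
        intro l hl
        rw [taylorCoeff_mul, map_sum]
        refine N.sum_mem fun p hp => ?_
        have := Finset.HasAntidiagonal.mem_antidiagonal.1 hp
        rw [Derivation.leibniz]
        exact N.add_mem (N.smul_mem _ (hy _ (by omega))) (N.smul_mem _ (hx _ (by omega)))
    have hbot : N = ⊥ := by
      -- Nakayama: d kills b and X, so the system places each generator in X • N.
      refine Submodule.eq_bot_of_le_smul_of_le_jacobson_bot (Ideal.span {X}) N
        (Submodule.fg_span (hs.image _)) ?_ ?_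
      · rw [hN, Submodule.span_le]
        rintro _ ⟨x, hx, rfl⟩
        obtain ⟨b, hb, y, hy, rfl⟩ := h x hx
        dsimp only
        rw [map_add, map_add, (hd _).2 (hb k), zero_add, taylorCoeff_X_mul, Derivation.leibniz,
          (hd _).2 isAlgebraic_X, smul_zero, add_zero]
        exact Submodule.smul_mem_smul (Ideal.mem_span_singleton_self _) (hcl y hy k le_rfl)
      · rw [IsLocalRing.jacobson_eq_maximalIdeal _ bot_ne_top, maximalIdeal_eq_span_X]
    intro x hx
    rw [← hd, ← Submodule.mem_bot (R := ℚ⟦X⟧), ← hbot]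
    exact hgen x hx k le_rfl

end DyckArea

/-! ### First-step and first-passage equations for walks -/

namespace DyckArea
open PowerSeries

/-- The weight enumerator of the walks with `n` steps from height `h` to height `r` that stay
weakly above the `x`-axis, where every step has as its weight the height of its starting point. -/
noncomputable def walkWeight (S : Finset ℤ) (r : ℤ) : ℕ → ℤ → ℚ[X]
  | 0, h => if 0 ≤ h ∧ h = r then 1 else 0
  | n + 1, h => if 0 ≤ h then Polynomial.X ^ h.toNat * ∑ s ∈ S, walkWeight S r n (h + s) else 0

/-- The generating function of `walkWeight`. -/
noncomputable def walkGF (S : Finset ℤ) (r h : ℤ) : ℚ[X]⟦X⟧ :=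
  mk fun n => walkWeight S r n h

theorem walkGF_of_neg (S : Finset ℤ) (r : ℤ) {h : ℤ} (hh : h < 0) : walkGF S r h = 0 := by
  ext1 n
  cases n <;> simp [walkGF, walkWeight, hh.not_ge]

theorem walkGF_of_nonneg (S : Finset ℤ) (r : ℤ) {h : ℤ} (hh : 0 ≤ h) :
    walkGF S r h = C (if h = r then 1 else 0) +
      X * (C (Polynomial.X ^ h.toNat) * ∑ s ∈ S, walkGF S r (h + s)) := by
  ext1 n
  cases n with
  | zero => simp [walkGF, walkWeight, hh]
  | succ n =>
    simp only [walkGF, walkWeight, hh, coeff_succ_X_mul, coeff_C, coeff_mk, map_add, coeff_C_mul,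
      map_sum, if_true, Nat.succ_ne_zero, if_false, zero_add]

theorem dilate_zero (c : ℕ) : dilate c 0 = 0 := by
  ext1 n
  simp [dilate]

theorem dilate_walkGF_of_nonneg (S : Finset ℤ) (c : ℕ) (r : ℤ) {h : ℤ} (hh : 0 ≤ h) :
    dilate c (walkGF S r h) = C (if h = r then 1 else 0) +
      X * (C (Polynomial.X ^ (h.toNat + c)) * ∑ s ∈ S, dilate c (walkGF S r (h + s))) := by
  ext1 n
  cases n with
  | zero => simp [dilate, walkGF, walkWeight, hh]
  | succ n =>
    simp only [dilate, walkGF, walkWeight, hh, coeff_succ_X_mul, coeff_C, coeff_mk, map_add,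
      coeff_C_mul, map_sum, if_true, Nat.succ_ne_zero, if_false, ← Finset.mul_sum]
    ring

/-- Linear systems of first-step type have at most one solution. -/
theorem eq_of_first_step (S : Finset ℤ) (u y a b : ℤ → ℚ[X]⟦X⟧)
    (ha0 : ∀ h < 0, a h = 0) (hb0 : ∀ h < 0, b h = 0)
    (ha : ∀ h, 0 ≤ h → a h = y h + X * (u h * ∑ s ∈ S, a (h + s)))
    (hb : ∀ h, 0 ≤ h → b h = y h + X * (u h * ∑ s ∈ S, b (h + s))) : a = b := by
  -- Each use of the homogeneous recursion gains a factor X.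
  have key : ∀ n h, X ^ n ∣ a h - b h := by
    intro n
    induction n with
    | zero => simp
    | succ n ih =>
      intro h
      rcases lt_or_ge h 0 with hh | hh
      · simp [ha0 h hh, hb0 h hh]
      · have : a h - b h = X * (u h * ∑ s ∈ S, (a (h + s) - b (h + s))) := by
          rw [ha h hh, hb h hh, Finset.sum_sub_distrib]
          ring
        rw [this, pow_succ']
        exact mul_dvd_mul_left _ (Dvd.dvd.mul_left (Finset.dvd_sum fun s _ => ih _) _)
  funext h
  ext1 n
  rw [← sub_eq_zero, ← map_sub]
  exact X_pow_dvd_iff.1 (key (n + 1) h) n n.lt_succ_self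

/-- Decomposition of a walk that starts at height at least `c` and ends below `c` at its first
passage below `c`. -/
theorem walkGF_add (S : Finset ℤ) (c : ℕ) (hS : ∀ s ∈ S, -(c : ℤ) ≤ s) {r : ℤ} (hrc : r < c)
    {h : ℤ} (hh : 0 ≤ h) :
    walkGF S r (h + c) = ∑ p ∈ Finset.range c, dilate c (walkGF S p h) *
      (X * (C (Polynomial.X ^ (p + c)) *
        ∑ s ∈ S, if (p : ℤ) + s < 0 then walkGF S r (p + s + c) else 0)) := by
  -- The contribution of walks from h + c whose very first step passes below c. Both sides of the
  -- claim solve the first-step system with this source term.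
  let y : ℤ → ℚ[X]⟦X⟧ := fun h => X * (C (Polynomial.X ^ (h.toNat + c)) *
    ∑ s ∈ S, if h + s < 0 then walkGF S r (h + s + c) else 0)
  have key := eq_of_first_step S (fun h => C (Polynomial.X ^ (h.toNat + c))) y
    (fun h => if h < 0 then 0 else walkGF S r (h + c))
    (fun h => ∑ p ∈ Finset.range c, dilate c (walkGF S p h) * y p)
    (fun h hh => if_pos hh)
    (fun h hh => by simp [walkGF_of_neg _ _ hh, dilate_zero]) ?_ ?_
  · have := congrFun key h
    simpa only [if_neg hh.not_gt, y, Int.toNat_natCast] using this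
  · intro h hh
    dsimp only [y]
    rw [if_neg hh.not_gt, walkGF_of_nonneg S r (by omega : 0 ≤ h + c), if_neg (by omega), map_zero,
      zero_add, ← mul_add, ← mul_add, ← Finset.sum_add_distrib]
    have : (h + c).toNat = h.toNat + c := by omega
    rw [this]
    congr 2
    refine Finset.sum_congr rfl fun s _ => ?_
    rw [add_right_comm]
    split_ifs <;> simp
  · intro h hh
    -- For h ≥ c no step from h + c can pass below c, so p < c suffices.
    have hy : ∑ p ∈ Finset.range c, C (if h = (p : ℤ) then (1 : ℚ[X]) else 0) * y p = y h := by
      lift h to ℕ using hh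
      rcases lt_or_ge h c with hc | hc
      · rw [Finset.sum_eq_single_of_mem h (Finset.mem_range.2 hc)]
        · simp
        · intro b _ hb
          rw [if_neg (by exact_mod_cast hb.symm)]
          simp
      · rw [Finset.sum_eq_zero]
        · dsimp only [y]
          rw [Finset.sum_eq_zero]
          · simp
          · intro s hs
            have := hS s hs
            rw [if_neg (by omega)]
        · intro p hp
          have := Finset.mem_range.1 hp
          rw [if_neg (by omega)]
          simp
    calc _ = ∑ p ∈ Finset.range c, (C (if h = (p : ℤ) then (1 : ℚ[X]) else 0) * y p +
          X * (C (Polynomial.X ^ (h.toNat + c)) *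
            ∑ s ∈ S, dilate c (walkGF S p (h + s)) * y p)) := by
          refine Finset.sum_congr rfl fun p _ => ?_
          rw [dilate_walkGF_of_nonneg S c p hh, ← Finset.sum_mul]
          ring
      _ = _ := by
          rw [Finset.sum_add_distrib, hy, ← Finset.mul_sum, ← Finset.mul_sum, Finset.sum_comm]

theorem walkGF_mem_algebraicSubring (S : Finset ℤ) (c : ℕ) (hS : ∀ s ∈ S, |s| ≤ c) (r h : ℕ)
    (hr : r < c) (hh : h < c) : walkGF S r h ∈ algebraicSubring := by
  let s : Set ℚ[X]⟦X⟧ := (fun p : ℕ × ℕ => walkGF S p.1 p.2) ''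
    (Finset.range c ×ˢ Finset.range c : Finset (ℕ × ℕ))
  have hs : ∀ r h : ℕ, r < c → h < c → walkGF S r h ∈ s := fun r h hr hh =>
    ⟨(r, h), by simp [hr, hh], rfl⟩
  refine subset_algebraicSubring_of_system c s ((Finset.finite_toSet _).image _) ?_ (hs r h hr hh)
  rintro _ ⟨⟨r, h⟩, hrh, rfl⟩
  obtain ⟨hr, hh⟩ : r < c ∧ h < c := by simpa using hrh
  refine ⟨_, C_mem_algebraicSubring _, _, ?_, walkGF_of_nonneg S r (Int.natCast_nonneg h)⟩
  set T := Subring.closure ((algebraicSubring : Set ℚ[X]⟦X⟧) ∪ s ∪ dilate c '' s)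
  have hB : ∀ b ∈ algebraicSubring, b ∈ T := fun b hb => Subring.subset_closure (.inl (.inl hb))
  have hlow : ∀ z : ℤ, z < c → walkGF S r z ∈ T := fun z hz => by
    rcases lt_or_ge z 0 with h0 | h0
    · rw [walkGF_of_neg S r h0]
      exact T.zero_mem
    · lift z to ℕ using h0
      exact Subring.subset_closure (.inl (.inr (hs r z hr (by omega))))
  refine T.mul_mem (hB _ (C_mem_algebraicSubring _)) (T.sum_mem fun a ha => ?_)
  have haS := abs_le.1 (hS a ha)
  rcases lt_or_ge ((h : ℤ) + a) c with hc | hc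
  · exact hlow _ hc
  -- Here z < c, as h < c and a ≤ c, so only dilations of the chosen unknowns occur.
  · obtain ⟨z, hz⟩ : ∃ z : ℕ, (h : ℤ) + a = z + c := ⟨((h : ℤ) + a - c).toNat, by omega⟩
    rw [hz, walkGF_add S c (fun s hs => (abs_le.1 (hS s hs)).1) (by omega) (Int.natCast_nonneg z)]
    refine T.sum_mem fun p hp => T.mul_mem ?_ (T.mul_mem (hB _ X_mem_algebraicSubring)
      (T.mul_mem (hB _ (C_mem_algebraicSubring _)) (T.sum_mem fun b _ => ?_)))
    · exact Subring.subset_closure (.inr ⟨_, hs p z (Finset.mem_range.1 hp) (by omega), rfl⟩)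
    · split_ifs with hb
      · exact hlow _ (by omega)
      · exact T.zero_mem

/-! ### Identification with the area enumerator -/

theorem sum_piFinset_succ {α M : Type*} [DecidableEq α] [AddCommMonoid M] (S : Finset α) (n : ℕ)
    (g : (Fin (n + 1) → α) → M) :
    ∑ w ∈ Fintype.piFinset fun _ : Fin (n + 1) => S, g w =
      ∑ s ∈ S, ∑ w ∈ Fintype.piFinset fun _ : Fin n => S, g (Fin.cons s w) := by
  rw [← Finset.sum_product']
  refine Finset.sum_nbij' (fun w => (w 0, Fin.tail w)) (fun p => Fin.cons p.1 p.2) ?_ ?_ ?_ ?_ ?_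
  · intro w hw
    simp only [Fintype.mem_piFinset, Finset.mem_product] at hw ⊢
    exact ⟨hw 0, fun i => hw i.succ⟩
  · intro p hp
    simp only [Fintype.mem_piFinset, Finset.mem_product] at hp ⊢
    exact Fin.cases hp.1 hp.2
  · intro w _
    exact Fin.cons_self_tail w
  · intro p _
    simp
  · intro w _
    simp

theorem height_zero {n : ℕ} (w : Fin n → ℤ) : height w 0 = 0 := by
  simp [height]

theorem height_cons_succ {n : ℕ} (s : ℤ) (w : Fin n → ℤ) (m : ℕ) :
    height (Fin.cons s w : Fin (n + 1) → ℤ) (m + 1) = s + height w m := by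
  simp [height, Finset.sum_filter, Fin.sum_univ_succ]

/-- Removing the first step shifts the starting height, so the induction needs arbitrary h. -/
theorem sum_pow_eq_walkWeight (S : Finset ℤ) (n : ℕ) (h : ℤ) :
    (∑ w ∈ Fintype.piFinset fun _ : Fin n => S,
      if (∀ m : Fin (n + 1), 0 ≤ h + height w m) ∧ h + height w n = 0 then
        (Polynomial.X : ℚ[X]) ^ ∑ m ∈ Finset.range n, (h + height w m).toNat else 0) =
      walkWeight S 0 n h := by
  induction n generalizing h with
  | zero => simp [walkWeight, height_zero]
  | succ n ih =>
    rw [sum_piFinset_succ, walkWeight]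
    simp only [Fin.forall_fin_succ (n := n + 1), Fin.val_zero, height_zero, add_zero, Fin.val_succ,
      height_cons_succ, Finset.sum_range_succ', ← add_assoc, ← ih]
    split_ifs with hh
    · simp only [hh, true_and, pow_add, Finset.mul_sum, mul_ite, mul_zero,
        mul_comm _ (Polynomial.X ^ h.toNat)]
    · simp [hh]

theorem area_eq_sum_range (S : Finset ℤ) {n : ℕ} {w : Fin n → ℤ} (hw : w ∈ walks S n) :
    area w = ∑ m ∈ Finset.range n, (height w m).toNat := by
  have h0 := (Finset.mem_filter.1 hw).2.1
  have hsum : ∑ m ∈ Finset.Ioo 0 n, height w m = ∑ m ∈ Finset.range n, height w m := by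
    refine Finset.sum_subset (fun m hm => ?_) fun m hm hm' => ?_
    · simp only [Finset.mem_Ioo, Finset.mem_range] at hm ⊢
      exact hm.2
    · simp only [Finset.mem_Ioo, Finset.mem_range, not_and] at hm hm'
      obtain rfl : m = 0 := by omega
      exact height_zero w
  have hnn : ∀ m ∈ Finset.range n, ((height w m).toNat : ℤ) = height w m := fun m hm =>
    Int.toNat_of_nonneg (h0 ⟨m, by have := Finset.mem_range.1 hm; omega⟩)
  rw [area, hsum, ← Finset.sum_congr rfl hnn, ← Nat.cast_sum, Int.toNat_natCast]

theorem areaGF_eq_walkGF (S : Finset ℤ) : areaGF S = walkGF S 0 0 := by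
  ext1 n
  rw [areaGF, walkGF, coeff_mk, coeff_mk, ← sum_pow_eq_walkWeight]
  simp only [zero_add]
  rw [← Finset.sum_filter]
  exact Finset.sum_congr rfl fun w hw => by rw [area_eq_sum_range S hw]

theorem areaCoeff_eq_taylorCoeff (S : Finset ℤ) (k : ℕ) :
    areaCoeff S k = taylorCoeff k (areaGF S) := by
  ext n
  rw [coeff_taylorCoeff, areaCoeff, coeff_mk]

theorem factorial_mul_coeff_areaCoeff (S : Finset ℤ) (k n : ℕ) :
    (k ! : ℚ) * coeff n (areaCoeff S k) = ∑ w ∈ walks S n, ((area w).descFactorial k : ℚ) := by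
  rw [areaCoeff, coeff_mk, areaGF, coeff_mk, map_sum, Polynomial.finsetSum_coeff, Finset.mul_sum]
  refine Finset.sum_congr rfl fun w _ => ?_
  rw [Polynomial.taylor_X_pow, map_one, Polynomial.coeff_X_add_one_pow,
    Nat.descFactorial_eq_factorial_mul_choose]
  push_cast
  rfl

theorem isAlgebraic_areaCoeff (S : Finset ℤ) (k : ℕ) : IsAlgebraic ℚ[X] (areaCoeff S k) := by
  rw [areaCoeff_eq_taylorCoeff, areaGF_eq_walkGF]
  obtain ⟨c, hc⟩ : ∃ c : ℕ, ∀ s ∈ S, |s| ≤ c := by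
    refine ⟨∑ s ∈ S, s.natAbs, fun s hs => ?_⟩
    rw [Int.abs_eq_natAbs]
    exact_mod_cast Finset.single_le_sum (f := Int.natAbs) (fun _ _ => Nat.zero_le _) hs
  -- The shift to c + 1 ensures that height 0 lies strictly below the bound.
  exact walkGF_mem_algebraicSubring S (c + 1) (fun s hs => (hc s hs).trans (by simp)) 0 0
    c.succ_pos c.succ_pos k

end DyckArea

theorem mainTheorem1 (S : Finset ℤ) (hpos : ∃ s ∈ S, 0 < s) (hneg : ∃ s ∈ S, s < 0) (k : ℕ) :
    (∀ n : ℕ, (k ! : ℚ) * PowerSeries.coeff n (DyckArea.areaCoeff S k) =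
        ∑ w ∈ DyckArea.walks S n, ((DyckArea.area w).descFactorial k : ℚ)) ∧
      IsAlgebraic ℚ[X] (DyckArea.areaCoeff S k) :=
  ⟨DyckArea.factorial_mul_coeff_areaCoeff S k, DyckArea.isAlgebraic_areaCoeff S k⟩
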